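/- Let $\alpha=(\sqrt5-1)/2$, let $q_n$ be the $n$-th Fibonacci number ($q_1=q_2=1$, $q_{n+2}=q_{n+1}+q_n$), and for a function $g:\mathbb{R}/\mathbb{Z}\to\mathbb{R}$ put $S_m(g)=\sum_{k=1}^{m} g(k\alpha)$, the Birkhoff sum of $g$ along the orbit of $\theta=0$ under the rotation $\theta\mapsto\theta+\alpha$. Write $[\cdot]$ for the integer part. (1) For every $x\in[0,1]$ the limit $$ s(x)=\lim_{n\to\infty}\frac{S_{[q_{2n}x]}(\cot(\pi\,\cdot))}{q_{2n}} $$ exists; the graph of $s$ is called the golden graph. (2) Let $g:\mathbb{R}/\mathbb{Z}\to\mathbb{R}$ be continuous away from $0$ and have a single, simple pole at $0$, that is, for some $r\in\mathbb{R}$ the function $g(t)-r/t$ has a finite limit as $t\to0$, $t\neq 0$ (the removable case $r=0$ is allowed). Then, with $c=\pi r$, there is a continuous function $F:\mathbb{R}/\mathbb{Z}\to\mathbb{R}$ such that $g(\theta)=c\cot(\pi\theta)+F(\theta)$ for all $\theta\neq0$, and for every $x\in[0,1]$ the Birkhoff limiting function of $g$ at $\theta=0$ exists and equals $$ \lim_{n\to\infty}\frac{S_{[q_{2n}x]}(g)}{q_{2n}}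 = c\,s(x)+M x,\qquad M=\int_0^1F(\theta)\,d\theta . $$ -/

import Mathlib

open Filter Topology

noncomputable section

/-- The golden rotation number `(√5 - 1) / 2`. -/
def goldenAlpha : ℝ := (Real.sqrt 5 - 1) / 2

/-- `q_n`, the denominator of the `n`-th convergent of `goldenAlpha`
(`0/1, 1/1, 1/2, 2/3, …` for `n = 1, 2, 3, 4, …`): the Fibonacci numbers `1, 1, 2, 3, 5, …`. -/
def goldenDenom (n : ℕ) : ℕ := Nat.fib n

/-- The Birkhoff sum `S_m(θ) = ∑_{k=1}^m g(θ + k α)` over the golden rotation of the circle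
`ℝ / ℤ`. -/
def goldenBirkhoffSum (g : UnitAddCircle → ℝ) (m : ℕ) (θ : UnitAddCircle) : ℝ :=
  ∑ k ∈ Finset.Icc 1 m, g (θ + (((k : ℝ) * goldenAlpha : ℝ) : UnitAddCircle))

/-- The rescaled random walk `s_m(x) = S_{[m x]} / m` along the orbit of `θ = 0`. -/
def birkhoffFunction (g : UnitAddCircle → ℝ) (m : ℕ) (x : ℝ) : ℝ :=
  goldenBirkhoffSum g ⌊(m : ℝ) * x⌋₊ 0 / (m : ℝ)

theorem periodic_cot_pi : Function.Periodic (fun x : ℝ => Real.cot (Real.pi * x)) 1 := by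
  intro x
  simp only [Real.cot_eq_cos_div_sin, mul_add, mul_one, Real.cos_add_pi, Real.sin_add_pi,
    neg_div_neg_eq]

/-- `x ↦ cot (π x)` as a function on the circle `ℝ / ℤ` (with the irrelevant value `0` at `0`). -/
def circleCot : UnitAddCircle → ℝ := periodic_cot_pi.lift

/-- The function `s(x) = lim_n S_{[q_{2n} x]} / q_{2n}` for `g = cot (π ·)`, whose graph over
`[0, 1]` is the golden graph. -/
def goldenGraph (x : ℝ) : ℝ :=
  limUnder atTop (fun n : ℕ => birkhoffFunction circleCot (goldenDenom (2 * n)) x)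

/-- `g` is continuous on the circle away from `0` and has at `0` a simple pole with residue `r`:
in the coordinate `t` near `0`, the difference of `g` and the principal part `r / t` extends
continuously to `0`. (For `r = 0` the singularity is removable.) -/
structure HasSinglePole (g : UnitAddCircle → ℝ) (r : ℝ) : Prop where
  continuousOn : ContinuousOn g {0}ᶜ
  pole : ∃ L : ℝ, Tendsto (fun t : ℝ => g (t : UnitAddCircle) - r / t) (𝓝[≠] 0) (𝓝 L)

end

/-! Subtracting `π r cot(π θ)` cancels the pole, so `g` is a multiple of the cotangent plus a
continuous `F`. By Weyl equidistribution `F` contributes its mean times `x`; all the work lies in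
the cotangent.

Let `q = q_{2n}` and truncate the cotangent at height `η q`. Any sum of at most `q` truncated terms
is `O(√η q)` uniformly in `n` (`exists_abs_sum_clamp_le`): cut it into blocks of Fibonacci length,
apply a Denjoy–Koksma bound to each (`abs_sum_clamp_cotPi_le`), and add a geometric series.

The excess over the truncation comes only from `k ≤ q` with `k α` within `1 / (2 η q)` of an integer
`p`. Multiplication by the unit `α ^ (2n)` is an automorphism of the lattice `ℤ[α]`, and its inverse
carries these `(k, p)` into a box independent of `n` (`exists_sum_eq_sum_latticeTerm`). So the
excess is a fixed finite sum of terms, each of which converges (`exists_tendsto_latticeTerm`). The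
even exponent makes the unit positive, so the sign of `k α - p` does not alternate with `n`. Letting
`η → 0` shows that the normalized sums are Cauchy. -/

/-! ### The cotangent -/

/-- `x ↦ cot (π x)` on the real line. -/
noncomputable def cotPi (x : ℝ) : ℝ := Real.cot (Real.pi * x)

theorem cotPi_add_int (x : ℝ) (n : ℤ) : cotPi (x + n) = cotPi x := by
  simpa [cotPi] using periodic_cot_pi.int_mul n x

theorem cotPi_neg (x : ℝ) : cotPi (-x) = -cotPi x := by
  simp [cotPi, Real.cot_eq_cos_div_sin, div_neg]

theorem cotPi_le_of_le {u v : ℝ} (hu : 0 < u) (huv : u ≤ v) (hv : v < 1) :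
    cotPi v ≤ cotPi u := by
  have hpi := Real.pi_pos
  have hsu : 0 < Real.sin (Real.pi * u) :=
    Real.sin_pos_of_pos_of_lt_pi (by positivity) (by nlinarith)
  have hsv : 0 < Real.sin (Real.pi * v) :=
    Real.sin_pos_of_pos_of_lt_pi (by nlinarith) (by nlinarith)
  have hd : 0 ≤ Real.sin (Real.pi * v - Real.pi * u) :=
    Real.sin_nonneg_of_nonneg_of_le_pi (by nlinarith) (by nlinarith)
  rw [Real.sin_sub] at hd
  rw [cotPi, cotPi, Real.cot_eq_cos_div_sin, Real.cot_eq_cos_div_sin, div_le_div_iff₀ hsv hsu]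
  linarith

theorem abs_cotPi_le {t : ℝ} (ht : |t| ≤ 1 / 2) (h0 : t ≠ 0) : |cotPi t| ≤ 1 / (2 * |t|) := by
  have hpi := Real.pi_pos
  have h1 := Real.mul_abs_le_abs_sin (x := Real.pi * t)
    (by rw [abs_mul, abs_of_pos hpi]; nlinarith)
  rw [abs_mul, abs_of_pos hpi, ← mul_assoc, div_mul_cancel₀ _ hpi.ne'] at h1
  have h2 : 0 < 2 * |t| := by positivity
  rw [cotPi, Real.cot_eq_cos_div_sin, abs_div]
  exact div_le_div₀ zero_le_one (Real.abs_cos_le_one _) h2 h1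

theorem tendsto_mul_cotPi : Tendsto (fun t : ℝ => t * cotPi t) (𝓝[≠] 0) (𝓝 Real.pi⁻¹) := by
  have hpi := Real.pi_pos
  have h1 : HasDerivAt (fun t : ℝ => Real.sin (Real.pi * t)) Real.pi 0 := by
    simpa using ((hasDerivAt_id (0 : ℝ)).const_mul Real.pi).sin
  have h2 := (hasDerivAt_iff_tendsto_slope.1 h1).inv₀ hpi.ne'
  have h3 : Tendsto (fun t : ℝ => Real.cos (Real.pi * t)) (𝓝[≠] 0) (𝓝 1) := by
    have : Continuous fun t : ℝ => Real.cos (Real.pi * t) := by fun_prop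
    simpa using (this.tendsto 0).mono_left nhdsWithin_le_nhds
  refine (by simpa using h2.mul h3 : Tendsto _ _ _).congr' ?_
  filter_upwards with t
  simp [cotPi, Real.cot_eq_cos_div_sin, slope_def_field]
  ring

/-! ### Truncation -/

/-- The truncation of `y` to the interval `[-M, M]`. -/
noncomputable def clamp (M y : ℝ) : ℝ := max (-M) (min M y)

theorem abs_clamp_le {M : ℝ} (hM : 0 ≤ M) (y : ℝ) : |clamp M y| ≤ M := by
  rw [abs_le, clamp]
  exact ⟨le_max_left _ _, max_le (by linarith) (min_le_left _ _)⟩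

theorem clamp_neg {M : ℝ} (hM : 0 ≤ M) (y : ℝ) : clamp M (-y) = -clamp M y := by
  unfold clamp
  grind

theorem clamp_mono (M : ℝ) {y z : ℝ} (h : y ≤ z) : clamp M y ≤ clamp M z :=
  max_le_max le_rfl (min_le_min le_rfl h)

theorem clamp_of_abs_le {M y : ℝ} (h : |y| ≤ M) : clamp M y = y := by
  rw [abs_le] at h
  rw [clamp, min_eq_right h.2, max_eq_right h.1]

theorem clamp_eq_clamp_min {M K y : ℝ} (h : |y| ≤ K) :
    clamp M y = clamp (min M K) y := by
  rw [abs_le] at h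
  unfold clamp
  grind

theorem clamp_mul {q : ℝ} (hq : 0 < q) (M y : ℝ) : clamp (M * q) y = clamp M (y / q) * q := by
  unfold clamp
  rw [max_mul_of_nonneg _ _ hq.le, min_mul_of_nonneg _ _ hq.le, div_mul_cancel₀ _ hq.ne', neg_mul]

theorem continuous_clamp (M : ℝ) : Continuous (clamp M) := by
  unfold clamp
  fun_prop

/-! ### A Denjoy–Koksma bound -/

theorem sum_range_zmod (Q : ℕ) [NeZero Q] (H : ZMod Q → ℝ) :
    ∑ k ∈ Finset.range Q, H (k : ZMod Q) = ∑ i, H i := by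
  refine Finset.sum_nbij' (fun k => (k : ZMod Q)) ZMod.val (by simp) ?_ ?_ (by simp) (by simp)
  · intro i _
    simpa using ZMod.val_lt i
  · intro k hk
    exact ZMod.val_cast_of_lt (by simpa using hk)

theorem sum_range_zmod_affine (Q : ℕ) [NeZero Q] (p : ℕ) (hp : p.Coprime Q) (a : ℤ)
    (H : ZMod Q → ℝ) :
    ∑ k ∈ Finset.range Q, H ((a + k * p : ℤ) : ZMod Q) = ∑ i, H i := by
  have h := sum_range_zmod Q (fun i => H (a + i * p))
  push_cast
  rw [h]
  exact (((Units.mulRight (ZMod.unitOfCoprime p hp)).trans (Equiv.addLeft (a : ZMod Q))).sum_comp H)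

/-- The points `θ + k β` shadow the rational points `(⌊θ Q⌋ + k p) / Q`, which run once through all
multiples of `1 / Q` mod 1. Over those the odd function sums to zero, and monotonicity between
consecutive poles controls the error except at four points. -/
theorem abs_sum_clamp_cotPi_le {Q p : ℕ} (hQ : 0 < Q) (hp : p.Coprime Q) {β M : ℝ} (hM : 0 ≤ M)
    (hβ : |Q * β - p| ≤ 1 / Q) (θ : ℝ) :
    |∑ k ∈ Finset.range Q, clamp M (cotPi (θ + k * β))| ≤ 8 * M := by
  have : NeZero Q := ⟨hQ.ne'⟩
  have hQ' : (0 : ℝ) < Q := by exact_mod_cast hQ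
  set f : ℝ → ℝ := fun x => clamp M (cotPi x) with hf
  have fper (x : ℝ) (n : ℤ) : f (x + n) = f x := by simp only [hf, cotPi_add_int]
  have fneg (x : ℝ) : f (-x) = -f x := by simp only [hf, cotPi_neg, clamp_neg hM]
  have fbd (x : ℝ) : |f x| ≤ M := abs_clamp_le hM _
  have fanti {u v : ℝ} (n : ℤ) (hu : n < u) (huv : u ≤ v) (hv : v < n + 1) : f v ≤ f u := by
    have := cotPi_le_of_le (u := u - n) (v := v - n) (by linarith) (by linarith) (by linarith)
    have h2 := clamp_mono M this
    rw [← cotPi_add_int _ n, ← cotPi_add_int (u - n) n] at h2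
    simpa [hf] using h2
  let G : ZMod Q → ℝ := fun i => f (i.val / Q)
  have hG (n : ℤ) : G (n : ZMod Q) = f (n / Q) := by
    have h1 : ((n : ZMod Q).val : ℝ) = ((n % Q : ℤ) : ℝ) := by
      rw [← ZMod.val_intCast]; simp
    have h2 : (n : ℝ) = ((n % Q : ℤ) : ℝ) + Q * ((n / Q : ℤ) : ℝ) := by
      exact_mod_cast (Int.emod_add_mul_ediv n Q).symm
    change f (_ / _) = _
    rw [h1, h2, add_div, mul_div_cancel_left₀ _ hQ'.ne', fper]
  have hG0 : ∑ i, G i = 0 := by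
    have h1 : ∑ i, G (-i) = ∑ i, G i := Equiv.sum_comp (Equiv.neg (ZMod Q)) G
    have h2 (i : ZMod Q) : G (-i) = -G i := by
      -- Oddness also holds at the pole `i = 0`, where division by zero gives the cotangent the
      -- value `0`.
      have h := hG (-(i.val : ℤ))
      have h' := hG (i.val : ℤ)
      push_cast at h h'
      rw [ZMod.natCast_zmod_val] at h h'
      rw [h, h', neg_div, fneg]
    simp only [h2, Finset.sum_neg_distrib] at h1
    linarith
  set a : ℤ := ⌊θ * Q⌋ with ha
  -- With `N = a + k p`, the point `(θ + k β) Q` lies in `(N - 1, N + 2)`. The interval `[N - 1, N +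
  -- 2]` contains a multiple of `Q`, that is a pole, exactly for these residues of `N`; each then
  -- costs at most `2 M`.
  let bad : Finset (ZMod Q) := {1, 0, -1, -2}
  let I : ZMod Q → ℝ := fun i => if i ∈ bad then 1 else 0
  have hI : ∑ i, I i ≤ 4 := by
    simp only [I, Finset.sum_ite_mem, Finset.univ_inter, Finset.sum_const, nsmul_eq_mul, mul_one]
    exact_mod_cast Finset.card_le_four
  have key (k : ℕ) (hk : k ∈ Finset.range Q) :
      G ((a + 2 + k * p : ℤ) : ZMod Q) - 2 * M * I ((a + k * p : ℤ) : ZMod Q) ≤ f (θ + k * β) ∧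
      f (θ + k * β) ≤
        G ((a - 1 + k * p : ℤ) : ZMod Q) + 2 * M * I ((a + k * p : ℤ) : ZMod Q) := by
    rw [Finset.mem_range] at hk
    by_cases hb : ((a + k * p : ℤ) : ZMod Q) ∈ bad
    · have e : I ((a + k * p : ℤ) : ZMod Q) = 1 := if_pos hb
      have h1 := abs_le.1 (fbd (θ + k * β))
      have h2 := abs_le.1 (fbd ((((a + 2 + k * p : ℤ) : ZMod Q).val : ℝ) / Q))
      have h3 := abs_le.1 (fbd ((((a - 1 + k * p : ℤ) : ZMod Q).val : ℝ) / Q))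
      rw [e]
      exact ⟨by change f _ - _ ≤ _; linarith, by change _ ≤ f _ + _; linarith⟩
    · have e : I ((a + k * p : ℤ) : ZMod Q) = 0 := if_neg hb
      rw [e, hG, hG, mul_zero, sub_zero, add_zero]
      set y := θ + k * β with hy
      set N : ℤ := a + k * p with hN
      have hkQ : (k : ℝ) ≤ Q := by exact_mod_cast hk.le
      have hkQ' : (k : ℝ) * |Q * β - p| < 1 := by
        have hk1 : (k : ℝ) < Q := by exact_mod_cast hk
        have : (k : ℝ) * |Q * β - p| ≤ k * (1 / Q) :=
          mul_le_mul_of_nonneg_left hβ (Nat.cast_nonneg k)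
        have h' : (k : ℝ) * (1 / Q) < 1 := by rw [mul_one_div, div_lt_one hQ']; exact hk1
        linarith
      rw [← abs_of_nonneg (Nat.cast_nonneg (α := ℝ) k), ← abs_mul, abs_lt] at hkQ'
      have ha1 := Int.floor_le (θ * Q)
      have ha2 := Int.lt_floor_add_one (θ * Q)
      rw [← ha] at ha1 ha2
      have hNr : (N : ℝ) = a + k * p := by push_cast [hN]; ring
      have hyQ : y * Q = θ * Q + k * p + k * (Q * β - p) := by rw [hy]; ring
      have hy1 : (N : ℝ) - 1 < y * Q := by rw [hyQ, hNr]; linarith [hkQ'.1]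
      have hy2 : y * Q < (N : ℝ) + 2 := by rw [hyQ, hNr]; linarith [hkQ'.2]
      set n : ℤ := N / Q with hn
      have hemod := Int.emod_add_mul_ediv N Q
      rw [← hn] at hemod
      have hpos := Int.emod_nonneg N (b := (Q : ℤ)) (by exact_mod_cast hQ.ne')
      have hlt := Int.emod_lt_of_pos N (b := (Q : ℤ)) (by exact_mod_cast hQ)
      have hr (c : ℤ) (hc : (c : ZMod Q) ∈ bad) : N % Q ≠ c ∧ N % Q ≠ c + Q := by
        constructor <;> intro h <;> apply hb
        · have : (N : ZMod Q) = c := by rw [← hemod, h]; simp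
          rwa [this]
        · have : (N : ZMod Q) = c := by rw [← hemod, h]; simp
          rwa [this]
      have r1 := hr 1 (by simp [bad])
      have r0 := hr 0 (by simp [bad])
      have r2 := hr (-1) (by simp [bad])
      have r3 := hr (-2) (by simp [bad])
      have hlow : (Q : ℤ) * n + 2 ≤ N := by omega
      have hhigh : N + 3 ≤ (Q : ℤ) * n + Q := by omega
      have hlow' : (Q : ℝ) * n + 2 ≤ N := by exact_mod_cast hlow
      have hhigh' : (N : ℝ) + 3 ≤ (Q : ℝ) * n + Q := by exact_mod_cast hhigh
      have e1 : ((a + 2 + k * p : ℤ) : ℝ) = N + 2 := by rw [hNr]; push_cast; ring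
      have e2 : ((a - 1 + k * p : ℤ) : ℝ) = N - 1 := by rw [hNr]; push_cast; ring
      rw [e1, e2]
      have l1 : (n : ℝ) < (N - 1) / Q := by rw [lt_div_iff₀ hQ']; linarith
      have l2 : ((N : ℝ) - 1) / Q ≤ y := by rw [div_le_iff₀ hQ']; linarith
      have l3 : y ≤ ((N : ℝ) + 2) / Q := by rw [le_div_iff₀ hQ']; linarith
      have l4 : ((N : ℝ) + 2) / Q < n + 1 := by rw [div_lt_iff₀ hQ']; linarith
      exact ⟨fanti n (by linarith) l3 l4, fanti n l1 l2 (by linarith)⟩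
  have s1 := Finset.sum_le_sum fun k hk => (key k hk).1
  have s2 := Finset.sum_le_sum fun k hk => (key k hk).2
  rw [Finset.sum_sub_distrib, ← Finset.mul_sum, sum_range_zmod_affine Q p hp (a + 2),
    sum_range_zmod_affine Q p hp a, hG0] at s1
  rw [Finset.sum_add_distrib, ← Finset.mul_sum, sum_range_zmod_affine Q p hp (a - 1),
    sum_range_zmod_affine Q p hp a, hG0] at s2
  rw [abs_le]
  constructor <;> nlinarith

/-! ### Arithmetic of the golden rotation -/

theorem goldenAlpha_eq_neg_goldenConj : goldenAlpha = -Real.goldenConj := by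
  rw [goldenAlpha, Real.goldenConj]; ring

theorem irrational_goldenAlpha : Irrational goldenAlpha := by
  rw [goldenAlpha_eq_neg_goldenConj]
  exact Real.goldenConj_irrational.neg

theorem goldenAlpha_pos : 0 < goldenAlpha := by
  rw [goldenAlpha_eq_neg_goldenConj]
  linarith [Real.goldenConj_neg]

theorem goldenAlpha_lt_one : goldenAlpha < 1 := by
  rw [goldenAlpha_eq_neg_goldenConj]
  linarith [Real.neg_one_lt_goldenConj]

theorem goldenAlpha_sq : goldenAlpha ^ 2 = 1 - goldenAlpha := by
  rw [goldenAlpha_eq_neg_goldenConj, neg_sq, Real.goldenConj_sq]; ring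

theorem goldenRatio_mul_goldenAlpha : Real.goldenRatio * goldenAlpha = 1 := by
  rw [goldenAlpha_eq_neg_goldenConj, mul_neg, Real.goldenRatio_mul_goldenConj, neg_neg]

theorem mul_goldenAlpha_sub_ne_zero {k : ℤ} (hk : k ≠ 0) (p : ℤ) : k * goldenAlpha - p ≠ 0 := by
  simpa using ((irrational_goldenAlpha.intCast_mul hk).sub_intCast p).ne_zero

/-- Up to sign, `k ^ 2 - p k - p ^ 2` is the norm of `k α - p`, a nonzero integer, and the conjugate
factor is at most `4 k`. So `α` is badly approximable. -/
theorem one_le_four_mul_abs_sub {k : ℕ} (hk : 0 < k) {p : ℤ} (hp : |k * goldenAlpha - p| ≤ 1 / 2) :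
    1 ≤ 4 * k * |k * goldenAlpha - p| := by
  have h0 : (k : ℝ) * goldenAlpha - p ≠ 0 := by
    exact_mod_cast mul_goldenAlpha_sub_ne_zero (k := k) (by exact_mod_cast hk.ne') p
  have h1 : (k : ℝ) * goldenAlpha + (p + k) ≠ 0 := by
    have := mul_goldenAlpha_sub_ne_zero (k := k) (by exact_mod_cast hk.ne') (-(p + k))
    push_cast at this
    rwa [sub_neg_eq_add] at this
  have hprod : ((k : ℝ) * goldenAlpha - p) * (k * goldenAlpha + (p + k))
      = ((k ^ 2 - p * k - p ^ 2 : ℤ) : ℝ) := by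
    push_cast
    linear_combination (k : ℝ) ^ 2 * goldenAlpha_sq
  have hz : (k ^ 2 - p * k - p ^ 2 : ℤ) ≠ 0 := by
    intro h
    rw [h, Int.cast_zero] at hprod
    exact mul_ne_zero h0 h1 hprod
  have h2 : (1 : ℝ) ≤ |((k ^ 2 - p * k - p ^ 2 : ℤ) : ℝ)| := by
    rw [← Int.cast_abs]
    exact_mod_cast Int.one_le_abs hz
  rw [← hprod, abs_mul] at h2
  have hk1 : (1 : ℝ) ≤ k := by exact_mod_cast hk
  have h3 : |(k : ℝ) * goldenAlpha + (p + k)| ≤ 4 * k := by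
    have := goldenAlpha_pos
    have := goldenAlpha_lt_one
    rw [abs_le] at hp ⊢
    constructor <;> nlinarith
  nlinarith [abs_nonneg ((k : ℝ) * goldenAlpha - p)]

theorem abs_cotPi_mul_goldenAlpha_le {k : ℕ} (hk : 0 < k) : |cotPi (k * goldenAlpha)| ≤ 2 * k := by
  set p : ℤ := round (k * goldenAlpha)
  have h1 : |k * goldenAlpha - p| ≤ 1 / 2 := abs_sub_round _
  have h2 := one_le_four_mul_abs_sub hk h1
  have h0 : 0 < |k * goldenAlpha - p| := by
    by_contra h
    have := le_antisymm (not_lt.1 h) (abs_nonneg _)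
    rw [this] at h2
    norm_num at h2
  have h3 := cotPi_add_int (k * goldenAlpha - p) p
  rw [sub_add_cancel] at h3
  rw [h3]
  refine (abs_cotPi_le h1 (abs_pos.1 h0)).trans ?_
  rw [div_le_iff₀ (by positivity)]
  linarith

theorem abs_fib_mul_goldenAlpha_sub (j : ℕ) :
    |Nat.fib (j + 1) * goldenAlpha - Nat.fib j| = goldenAlpha ^ (j + 1) := by
  have h := Real.goldenConj_mul_fib_succ_add_fib j
  have e : Nat.fib (j + 1) * goldenAlpha - Nat.fib j = -Real.goldenConj ^ (j + 1) := by
    rw [← h, goldenAlpha_eq_neg_goldenConj]; ring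
  rw [e, abs_neg, abs_pow, abs_of_neg Real.goldenConj_neg, goldenAlpha_eq_neg_goldenConj]

theorem fib_succ_le_goldenRatio_pow (j : ℕ) : (Nat.fib (j + 1) : ℝ) ≤ Real.goldenRatio ^ j := by
  induction j using Nat.strong_induction_on with
  | _ j ih =>
    match j with
    | 0 => simp
    | 1 => simpa using Real.one_lt_goldenRatio.le
    | j + 2 =>
      have h1 := ih j (by omega)
      have h2 := ih (j + 1) (by omega)
      have h3 := Real.goldenRatio_pow_sub_goldenRatio_pow j
      rw [Nat.fib_add_two, Nat.cast_add]
      linarith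

theorem goldenRatio_pow_le_three_mul_fib {N : ℕ} (hN : 0 < N) :
    Real.goldenRatio ^ N ≤ 3 * Nat.fib N := by
  obtain ⟨j, rfl⟩ := Nat.exists_eq_add_of_lt hN
  rw [zero_add, ← Real.goldenRatio_mul_fib_succ_add_fib]
  have h1 : (Nat.fib j : ℝ) ≤ Nat.fib (j + 1) := by exact_mod_cast Nat.fib_le_fib_succ
  nlinarith [Real.goldenRatio_lt_two]

theorem goldenAlpha_pow_mul_goldenRatio_pow (j : ℕ) :
    goldenAlpha ^ j * Real.goldenRatio ^ j = 1 := by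
  rw [← mul_pow, mul_comm, goldenRatio_mul_goldenAlpha, one_pow]

theorem fib_mul_goldenAlpha_pow_le_one (j : ℕ) : Nat.fib j * goldenAlpha ^ j ≤ 1 := by
  have h1 : (Nat.fib j : ℝ) ≤ Real.goldenRatio ^ j := by
    have : (Nat.fib j : ℝ) ≤ Nat.fib (j + 1) := by exact_mod_cast Nat.fib_le_fib_succ
    exact this.trans (fib_succ_le_goldenRatio_pow j)
  rw [← goldenAlpha_pow_mul_goldenRatio_pow j, mul_comm]
  exact mul_le_mul_of_nonneg_left h1 (pow_nonneg goldenAlpha_pos.le _)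

theorem abs_fib_mul_goldenAlpha_sub_le (j : ℕ) :
    |Nat.fib (j + 1) * goldenAlpha - Nat.fib j| ≤ 1 / Nat.fib (j + 1) := by
  have h : (0 : ℝ) < Nat.fib (j + 1) := by exact_mod_cast Nat.fib_pos.2 j.succ_pos
  rw [abs_fib_mul_goldenAlpha_sub, le_div_iff₀ h, mul_comm]
  exact fib_mul_goldenAlpha_pow_le_one _

/-! ### Truncated Birkhoff sums of the cotangent -/

/-- Greedy Fibonacci decomposition of `m`: split off the last `fib (j + 1)` terms. Their indices are
at most `fib (j + 2)`, so bad approximability bounds the cotangents there by `2 * fib (j + 2)`, and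
truncating at `M` is the same as truncating at the minimum of the two. -/
theorem abs_sum_clamp_le_sum_min {M : ℝ} (hM : 0 ≤ M) (j : ℕ) :
    ∀ m < Nat.fib (j + 1),
      |∑ k ∈ Finset.range m, clamp M (cotPi ((k + 1 : ℕ) * goldenAlpha))|
        ≤ 8 * ∑ i ∈ Finset.range j, min M (2 * Nat.fib (i + 2)) := by
  induction j with
  | zero =>
    intro m hm
    obtain rfl : m = 0 := by simpa using hm
    simp
  | succ j ih =>
    intro m hm
    set K : ℝ := min M (2 * Nat.fib (j + 2)) with hK
    have hK0 : 0 ≤ K := le_min hM (by positivity)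
    rw [Finset.sum_range_succ, mul_add]
    by_cases h : m < Nat.fib (j + 1)
    · linarith [ih m h]
    · obtain ⟨m', rfl⟩ := Nat.exists_eq_add_of_le' (not_lt.1 h)
      have hfib : Nat.fib (j + 1 + 1) = Nat.fib j + Nat.fib (j + 1) := Nat.fib_add_two
      have hm' : m' < Nat.fib (j + 1) := by
        have := Nat.fib_le_fib_succ (n := j)
        omega
      have hb := abs_sum_clamp_cotPi_le (Nat.fib_pos.2 j.succ_pos) (Nat.fib_coprime_fib_succ j)
        hK0 (abs_fib_mul_goldenAlpha_sub_le j) ((m' + 1 : ℕ) * goldenAlpha)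
      have hc : ∑ k ∈ Finset.range (Nat.fib (j + 1)),
            clamp M (cotPi ((m' + k + 1 : ℕ) * goldenAlpha)) =
          ∑ k ∈ Finset.range (Nat.fib (j + 1)),
            clamp K (cotPi ((m' + 1 : ℕ) * goldenAlpha + k * goldenAlpha)) := by
        refine Finset.sum_congr rfl fun k hk => ?_
        rw [Finset.mem_range] at hk
        have hle : |cotPi ((m' + k + 1 : ℕ) * goldenAlpha)| ≤ 2 * Nat.fib (j + 2) := by
          refine (abs_cotPi_mul_goldenAlpha_le (by omega)).trans ?_
          have : m' + k + 1 ≤ Nat.fib (j + 2) := by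
            change _ ≤ Nat.fib (j + 1 + 1)
            omega
          have : ((m' + k + 1 : ℕ) : ℝ) ≤ Nat.fib (j + 2) := by exact_mod_cast this
          linarith
        rw [clamp_eq_clamp_min hle]
        congr 2
        push_cast
        ring
      rw [Finset.sum_range_add, hc]
      exact (abs_add_le _ _).trans (add_le_add (ih m' hm') hb)

theorem min_le_sqrt_mul {a b : ℝ} (ha : 0 ≤ a) (hb : 0 ≤ b) : min a b ≤ √(a * b) := by
  refine Real.le_sqrt_of_sq_le ?_
  have h := le_min ha hb
  nlinarith [min_le_left a b, min_le_right a b]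

/-- Bounding each minimum by a geometric mean turns the sum over blocks into a geometric series of
ratio `√φ`. Its last term has order `√(η q) * √q = √η * q`. -/
theorem exists_abs_sum_clamp_le :
    ∃ C : ℝ, 0 < C ∧ ∀ (N : ℕ) (_ : 0 < N) (η : ℝ) (_ : 0 ≤ η), ∀ m ≤ Nat.fib N,
      |∑ k ∈ Finset.range m, clamp (η * Nat.fib N) (cotPi ((k + 1 : ℕ) * goldenAlpha))|
        ≤ C * √η * Nat.fib N := by
  set s := √Real.goldenRatio with hs
  have hs1 : 1 < s := by
    rw [hs, Real.lt_sqrt zero_le_one]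
    simpa using Real.one_lt_goldenRatio
  have hpow (i : ℕ) : √(Real.goldenRatio ^ i) = s ^ i := by
    rw [hs, Real.sqrt_eq_iff_mul_self_eq (by positivity) (by positivity), ← mul_pow,
      Real.mul_self_sqrt Real.goldenRatio_pos.le]
  refine ⟨8 * √2 * s ^ 2 * √3 / (s - 1), by have := sub_pos.2 hs1; positivity, ?_⟩
  intro N hN η hη m hm
  have hq : (0 : ℝ) < Nat.fib N := by exact_mod_cast Nat.fib_pos.2 hN
  -- The block bound needs a strict inequality while `m = fib N` is allowed; `fib (N + 1)` would
  -- fail at `N = 1`.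
  have hm' : m < Nat.fib (N + 1 + 1) := by
    have : 0 < Nat.fib N := Nat.fib_pos.2 hN
    have h1 : Nat.fib N ≤ Nat.fib (N + 1) := Nat.fib_le_fib_succ
    have h2 : Nat.fib (N + 1 + 1) = Nat.fib N + Nat.fib (N + 1) := Nat.fib_add_two
    omega
  set q : ℝ := ((Nat.fib N : ℕ) : ℝ)
  refine (abs_sum_clamp_le_sum_min (by positivity) (N + 1) m hm').trans ?_
  have h1 (i : ℕ) : min (η * q) (2 * Nat.fib (i + 2)) ≤ √2 * √(η * q) * s * s ^ i := by
    calc min (η * q) (2 * (Nat.fib (i + 2) : ℝ))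
        ≤ min (η * q) (2 * Real.goldenRatio ^ (i + 1)) :=
          min_le_min le_rfl (by linarith [fib_succ_le_goldenRatio_pow (i + 1)])
      _ ≤ √(η * q * (2 * Real.goldenRatio ^ (i + 1))) :=
          min_le_sqrt_mul (by positivity) (by positivity)
      _ = √2 * √(η * q) * s * s ^ i := by
          rw [Real.sqrt_mul (x := η * q) (by positivity), Real.sqrt_mul (x := 2) (by norm_num), hpow]
          ring
  have h2 : ∑ i ∈ Finset.range (N + 1), s ^ i ≤ s ^ (N + 1) / (s - 1) := by
    rw [geom_sum_eq hs1.ne']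
    exact div_le_div_of_nonneg_right (by linarith) (by linarith)
  have h3 : s ^ N ≤ √3 * √q := by
    rw [← hpow, ← Real.sqrt_mul (by norm_num)]
    exact Real.sqrt_le_sqrt (goldenRatio_pow_le_three_mul_fib hN)
  have h4 : √(η * q) * √q = √η * q := by
    rw [Real.sqrt_mul hη, mul_assoc, Real.mul_self_sqrt hq.le]
  have hs0 : 0 < s - 1 := sub_pos.2 hs1
  calc 8 * ∑ i ∈ Finset.range (N + 1), min (η * q) (2 * Nat.fib (i + 2))
      ≤ 8 * ∑ i ∈ Finset.range (N + 1), √2 * √(η * q) * s * s ^ i := by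
        gcongr with i
        exact h1 i
    _ = 8 * (√2 * √(η * q) * s) * ∑ i ∈ Finset.range (N + 1), s ^ i := by
        rw [← Finset.mul_sum]; ring
    _ ≤ 8 * (√2 * √(η * q) * s) * (s ^ (N + 1) / (s - 1)) := by gcongr
    _ = 8 * √2 * s ^ 2 / (s - 1) * √(η * q) * s ^ N := by ring
    _ ≤ 8 * √2 * s ^ 2 / (s - 1) * √(η * q) * (√3 * √q) := by gcongr
    _ = 8 * √2 * s ^ 2 * √3 / (s - 1) * (√(η * q) * √q) := by ring
    _ = _ := by rw [h4]; ring

/-! ### Rescaling the lattice by powers of the unit `α²` -/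

theorem tendsto_fib_two_mul : Tendsto (fun n : ℕ => (Nat.fib (2 * n) : ℝ)) atTop atTop := by
  have h : Tendsto (fun n : ℕ => Real.goldenRatio ^ n / 3) atTop atTop :=
    (tendsto_pow_atTop_atTop_of_one_lt Real.one_lt_goldenRatio).atTop_div_const (by norm_num)
  refine tendsto_atTop_mono' _ ?_ h
  filter_upwards [eventually_gt_atTop 0] with n hn
  have h1 := goldenRatio_pow_le_three_mul_fib (N := 2 * n) (by omega)
  have h2 : Real.goldenRatio ^ n ≤ Real.goldenRatio ^ (2 * n) :=
    pow_le_pow_right₀ Real.one_lt_goldenRatio.le (by omega)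
  linarith

theorem tendsto_goldenAlpha_pow_two_mul :
    Tendsto (fun n : ℕ => goldenAlpha ^ (2 * n)) atTop (𝓝 0) :=
  (tendsto_pow_atTop_nhds_zero_of_lt_one goldenAlpha_pos.le goldenAlpha_lt_one).comp
    (tendsto_id.const_mul_atTop' two_pos)

theorem tendsto_fib_mul_goldenAlpha_pow :
    Tendsto (fun n : ℕ => Nat.fib (2 * n) * goldenAlpha ^ (2 * n)) atTop (𝓝 (1 / √5)) := by
  have h : Tendsto (fun n : ℕ => (1 - goldenAlpha ^ (2 * n) * goldenAlpha ^ (2 * n)) / √5) atTop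
      (𝓝 (1 / √5)) := by
    simpa using ((tendsto_goldenAlpha_pow_two_mul.mul
      tendsto_goldenAlpha_pow_two_mul).const_sub 1).div_const √5
  refine h.congr fun n => ?_
  have h1 : Real.goldenConj ^ (2 * n) = goldenAlpha ^ (2 * n) := by
    rw [goldenAlpha_eq_neg_goldenConj, (even_two_mul n).neg_pow]
  rw [Real.coe_fib_eq, h1, div_mul_eq_mul_div, sub_mul, mul_comm (Real.goldenRatio ^ _),
    goldenAlpha_pow_mul_goldenRatio_pow]

theorem fib_succ_two_mul_sub (n : ℕ) :
    (Nat.fib (2 * n + 1) : ℝ) - Real.goldenRatio * Nat.fib (2 * n) = goldenAlpha ^ (2 * n) := by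
  rw [Real.fib_succ_sub_goldenRatio_mul_fib, goldenAlpha_eq_neg_goldenConj,
    (even_two_mul n).neg_pow]

theorem goldenRatio_eq_one_add_goldenAlpha : Real.goldenRatio = 1 + goldenAlpha := by
  rw [goldenAlpha_eq_neg_goldenConj, ← sub_eq_add_neg, Real.one_sub_goldenRatio]

theorem fib_cassini (n : ℕ) :
    (Nat.fib (2 * n + 1) : ℤ) ^ 2 - Nat.fib (2 * n + 1) * Nat.fib (2 * n)
      - (Nat.fib (2 * n) : ℤ) ^ 2 = 1 := by
  have h1 := Real.fib_succ_sub_goldenRatio_mul_fib (2 * n)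
  have h2 := Real.fib_succ_sub_goldenConj_mul_fib (2 * n)
  have h3 : Real.goldenConj ^ (2 * n) * Real.goldenRatio ^ (2 * n) = 1 := by
    rw [← mul_pow, Real.goldenConj_mul_goldenRatio, (even_two_mul n).neg_one_pow]
  rw [← h1, ← h2] at h3
  have : (Nat.fib (2 * n + 1) : ℝ) ^ 2 - Nat.fib (2 * n + 1) * Nat.fib (2 * n)
      - (Nat.fib (2 * n) : ℝ) ^ 2 = 1 := by
    linear_combination h3
      + (Nat.fib (2 * n + 1) : ℝ) * Nat.fib (2 * n) * Real.goldenRatio_add_goldenConj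
      - (Nat.fib (2 * n) : ℝ) ^ 2 * Real.goldenRatio_mul_goldenConj
  exact_mod_cast this

/-- The growing term `(u φ + v) * fib (2n)` decides the sign; if its coefficient vanishes, `u * α ^
(2n)` has the constant sign of `u`. This degenerate case is what admits every `x`, including those
in `ℤ[φ]`. -/
theorem eventually_fib_combination_sign (u v : ℝ) :
    (∀ᶠ n : ℕ in atTop, u * Nat.fib (2 * n + 1) + v * Nat.fib (2 * n) ≤ 0) ∨
    (∀ᶠ n : ℕ in atTop, 0 < u * Nat.fib (2 * n + 1) + v * Nat.fib (2 * n)) := by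
  have e (n : ℕ) : u * Nat.fib (2 * n + 1) + v * Nat.fib (2 * n)
      = u * goldenAlpha ^ (2 * n) + (u * Real.goldenRatio + v) * Nat.fib (2 * n) := by
    rw [← fib_succ_two_mul_sub]; ring
  have hu := tendsto_goldenAlpha_pow_two_mul.const_mul u
  simp only [e]
  rcases lt_trichotomy (u * Real.goldenRatio + v) 0 with h | h | h
  · left
    exact (hu.add_atBot (tendsto_fib_two_mul.const_mul_atTop_of_neg h)).eventually_le_atBot 0
  · simp only [h, zero_mul, add_zero]
    rcases le_or_gt u 0 with hu' | hu'
    · left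
      exact .of_forall fun n => mul_nonpos_of_nonpos_of_nonneg hu' (pow_nonneg goldenAlpha_pos.le _)
    · right
      exact .of_forall fun n => mul_pos hu' (pow_pos goldenAlpha_pos _)
  · right
    exact (hu.add_atTop (tendsto_fib_two_mul.const_mul_atTop h)).eventually_gt_atTop 0

/-- The first coordinate of the image of the lattice point `(a, b)` under the `n`-th power of
the unit `α²`. -/
def scaledIndex (n : ℕ) (z : ℤ × ℤ) : ℤ := z.1 * Nat.fib (2 * n + 1) + z.2 * Nat.fib (2 * n)

/-- The second coordinate of the image of the lattice point `(a, b)` under the `n`-th power of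
the unit `α²`. -/
def scaledNumer (n : ℕ) (z : ℤ × ℤ) : ℤ :=
  z.1 * Nat.fib (2 * n) + z.2 * (Nat.fib (2 * n + 1) - Nat.fib (2 * n))

/-- Identifying `(a, b)` with `a α - b`, the scaling map is multiplication by `α ^ (2n)`.
`fib_cassini` says that its determinant is `1`. -/
theorem scaledIndex_mul_goldenAlpha_sub (n : ℕ) (z : ℤ × ℤ) :
    scaledIndex n z * goldenAlpha - scaledNumer n z
      = (z.1 * goldenAlpha - z.2) * goldenAlpha ^ (2 * n) := by
  rw [← fib_succ_two_mul_sub, goldenRatio_eq_one_add_goldenAlpha, scaledIndex, scaledNumer]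
  push_cast
  linear_combination (z.1 : ℝ) * Nat.fib (2 * n) * goldenAlpha_sq

/-- The inverse of `z ↦ (scaledIndex n z, scaledNumer n z)`. -/
def unscale (n : ℕ) (k p : ℤ) : ℤ × ℤ :=
  ((Nat.fib (2 * n + 1) - Nat.fib (2 * n)) * k - Nat.fib (2 * n) * p,
    Nat.fib (2 * n + 1) * p - Nat.fib (2 * n) * k)

theorem unscale_scaled (n : ℕ) (z : ℤ × ℤ) : unscale n (scaledIndex n z) (scaledNumer n z) = z := by
  have h := fib_cassini n
  ext
  · simp only [unscale, scaledIndex, scaledNumer]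
    linear_combination z.1 * h
  · simp only [unscale, scaledIndex, scaledNumer]
    linear_combination z.2 * h

theorem scaledIndex_unscale (n : ℕ) (k p : ℤ) : scaledIndex n (unscale n k p) = k := by
  have h := fib_cassini n
  simp only [unscale, scaledIndex]
  linear_combination k * h

theorem cotPi_scaledIndex (n : ℕ) (z : ℤ × ℤ) :
    cotPi (scaledIndex n z * goldenAlpha)
      = cotPi ((z.1 * goldenAlpha - z.2) * goldenAlpha ^ (2 * n)) := by
  rw [← scaledIndex_mul_goldenAlpha_sub, ← cotPi_add_int (_ - _) (scaledNumer n z), sub_add_cancel]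

theorem fib_succ_le_two_mul_fib {n : ℕ} (hn : 0 < n) : Nat.fib (n + 1) ≤ 2 * Nat.fib n := by
  obtain ⟨m, rfl⟩ := Nat.exists_eq_add_of_le' hn
  change Nat.fib (m + 1 + 1) ≤ 2 * Nat.fib (m + 1)
  have h4 : Nat.fib (m + 1 + 1) = Nat.fib m + Nat.fib (m + 1) := Nat.fib_add_two
  have h5 : Nat.fib m ≤ Nat.fib (m + 1) := Nat.fib_le_fib_succ
  omega

/-- Both coordinates are combinations of `k α ^ (2n) ≤ 1` and of `k α - p` times `fib (2n)` or `fib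
(2n + 1)`; the ratio of these two is at most `2`. -/
theorem abs_unscale_le {n : ℕ} (hn : 0 < n) {k : ℕ} {p : ℤ} {c : ℝ} (hk : k ≤ Nat.fib (2 * n))
    (hp : Nat.fib (2 * n) * |k * goldenAlpha - p| ≤ c) :
    |((unscale n k p).1 : ℝ)| ≤ 1 + 2 * c ∧ |((unscale n k p).2 : ℝ)| ≤ 1 + 2 * c := by
  have hkq : (k : ℝ) ≤ Nat.fib (2 * n) := by exact_mod_cast hk
  have hq2 : (Nat.fib (2 * n + 1) : ℝ) ≤ 2 * Nat.fib (2 * n) := by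
    exact_mod_cast fib_succ_le_two_mul_fib (by omega)
  have h1 := (mul_le_mul_of_nonneg_right hkq (pow_pos goldenAlpha_pos (2 * n)).le).trans
    (fib_mul_goldenAlpha_pow_le_one (2 * n))
  have h2 := fib_succ_two_mul_sub n
  rw [goldenRatio_eq_one_add_goldenAlpha] at h2
  simp only [unscale]
  push_cast
  have hq0 : (0 : ℝ) ≤ Nat.fib (2 * n) := Nat.cast_nonneg _
  have hq0' : (0 : ℝ) ≤ Nat.fib (2 * n + 1) := Nat.cast_nonneg _
  generalize (Nat.fib (2 * n) : ℝ) = q at *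
  generalize (Nat.fib (2 * n + 1) : ℝ) = q' at *
  have hα := goldenAlpha_pos
  have hα1 := goldenAlpha_lt_one
  have h1' : 0 ≤ (k : ℝ) * goldenAlpha ^ (2 * n) := by positivity
  have e1 : (q' - q) * k - q * p = k * goldenAlpha ^ (2 * n) + q * (k * goldenAlpha - p) := by
    rw [← h2]; ring
  have e2 : q' * p - q * k
      = goldenAlpha * (k * goldenAlpha ^ (2 * n)) - q' * (k * goldenAlpha - p) := by
    rw [← h2]
    linear_combination (k : ℝ) * q * goldenAlpha_sq
  rw [e1, e2]
  have h3 : |q * (k * goldenAlpha - p)| ≤ c := by rwa [abs_mul, abs_of_nonneg hq0]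
  have h4 : |q' * (k * goldenAlpha - p)| ≤ 2 * c := by
    rw [abs_mul, abs_of_nonneg hq0']
    nlinarith [abs_nonneg ((k : ℝ) * goldenAlpha - p)]
  rw [abs_le] at h3 h4 ⊢
  rw [abs_le]
  refine ⟨⟨?_, ?_⟩, ?_, ?_⟩ <;> nlinarith

/-- Once `N * α ^ (2n) < 1 / 2`, equal indices force the integer second coordinates to differ by
less than `1`. -/
theorem scaled_injOn (N : ℕ) :
    ∀ᶠ n : ℕ in atTop, ∀ z z' : ℤ × ℤ,
      |(z.1 : ℝ) * goldenAlpha - z.2| ≤ N → |(z'.1 : ℝ) * goldenAlpha - z'.2| ≤ N →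
      scaledIndex n z = scaledIndex n z' → z = z' := by
  have h := (tendsto_goldenAlpha_pow_two_mul.const_mul (N : ℝ)).eventually_lt_const
    (u := 1 / 2) (by norm_num)
  filter_upwards [h] with n hn z z' hz hz' he
  have h1 := scaledIndex_mul_goldenAlpha_sub n z
  have h2 := scaledIndex_mul_goldenAlpha_sub n z'
  rw [he] at h1
  have hpow : 0 < goldenAlpha ^ (2 * n) := pow_pos goldenAlpha_pos _
  have hnum : scaledNumer n z = scaledNumer n z' := by
    have h3 : |((scaledNumer n z - scaledNumer n z' : ℤ) : ℝ)| < 1 := by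
      push_cast
      rw [abs_le] at hz hz'
      rw [abs_lt]
      constructor <;> nlinarith
    rw [← Int.cast_abs] at h3
    have h4 : |scaledNumer n z - scaledNumer n z'| < 1 := by exact_mod_cast h3
    rw [Int.abs_lt_one_iff] at h4
    omega
  rw [← unscale_scaled n z, ← unscale_scaled n z', he, hnum]

/-! ### The contribution of the near returns -/

/-- The contribution of the lattice point `z`, moved by the `n`-th power of the unit `α²`, to the
sum of `w (cot (π k α) / q)` over `1 ≤ k ≤ q x`, where `q = q_{2n}`. -/
noncomputable def latticeTerm (w : ℝ → ℝ) (x : ℝ) (n : ℕ) (z : ℤ × ℤ) : ℝ :=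
  open Classical in
  if 0 < scaledIndex n z ∧ (scaledIndex n z : ℝ) ≤ Nat.fib (2 * n) * x then
    w (cotPi (scaledIndex n z * goldenAlpha) / Nat.fib (2 * n)) else 0

/-- Both conditions `0 < index` and `index ≤ q x` are eventually constant in `n`. When they hold,
the argument of `w` is asymptotic to `1 / (π μ α ^ (2n) q)`, which tends to `√5 / (π μ)`. -/
theorem exists_tendsto_latticeTerm {w : ℝ → ℝ} (hw : Continuous w) (x : ℝ) (z : ℤ × ℤ) :
    ∃ L, Tendsto (fun n => latticeTerm w x n z) atTop (𝓝 L) := by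
  have e1 (n : ℕ) : ((scaledIndex n z : ℤ) : ℝ)
      = z.1 * Nat.fib (2 * n + 1) + z.2 * Nat.fib (2 * n) := by
    simp [scaledIndex]
  rcases eventually_fib_combination_sign z.1 z.2 with h | h
  · refine ⟨0, tendsto_const_nhds.congr' ?_⟩
    filter_upwards [h] with n hn
    rw [← e1] at hn
    refine (if_neg fun h => ?_).symm
    have : scaledIndex n z ≤ 0 := by exact_mod_cast hn
    omega
  have hz : z ≠ 0 := by
    rintro rfl
    obtain ⟨n, hn⟩ := h.exists
    simp at hn
  rcases eventually_fib_combination_sign z.1 (z.2 - x) with h' | h'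
  · set μ : ℝ := z.1 * goldenAlpha - z.2 with hμ
    have hμ0 : μ ≠ 0 := by
      by_cases h1 : z.1 = 0
      · have h2 : z.2 ≠ 0 := fun h2 => hz (Prod.ext h1 h2)
        simpa [hμ, h1] using h2
      · exact mul_goldenAlpha_sub_ne_zero h1 _
    have hpos (n : ℕ) : goldenAlpha ^ (2 * n) ≠ 0 := (pow_pos goldenAlpha_pos _).ne'
    have ht : Tendsto (fun n : ℕ => μ * goldenAlpha ^ (2 * n)) atTop (𝓝[≠] 0) := by
      refine tendsto_nhdsWithin_iff.2 ⟨?_, .of_forall fun n => mul_ne_zero hμ0 (hpos n)⟩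
      simpa using tendsto_goldenAlpha_pow_two_mul.const_mul μ
    have h5 : (1 / √5 : ℝ) ≠ 0 := by positivity
    have hlim := (tendsto_mul_cotPi.comp ht).div
      (tendsto_fib_mul_goldenAlpha_pow.const_mul μ) (mul_ne_zero hμ0 h5)
    refine ⟨_, ((hw.tendsto _).comp hlim).congr' ?_⟩
    filter_upwards [h, h'] with n hn hn'
    have hc : 0 < scaledIndex n z ∧ (scaledIndex n z : ℝ) ≤ Nat.fib (2 * n) * x := by
      constructor
      · rw [← e1] at hn
        exact_mod_cast hn
      · rw [e1]
        linarith
    rw [latticeTerm, if_pos hc, cotPi_scaledIndex, ← hμ]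
    simp only [Function.comp_apply, Pi.div_apply]
    congr 1
    have := hpos n
    field_simp
  · refine ⟨0, tendsto_const_nhds.congr' ?_⟩
    filter_upwards [h'] with n hn
    refine (if_neg fun h => ?_).symm
    rw [e1] at h
    linarith [h.2]

theorem exists_sum_eq_sum_latticeTerm {w : ℝ → ℝ} {η : ℝ} (hη : 0 < η)
    (hw : ∀ y, |y| ≤ η → w y = 0) {x : ℝ} (hx0 : 0 ≤ x) (hx1 : x ≤ 1) :
    ∃ B : Finset (ℤ × ℤ), ∀ᶠ n : ℕ in atTop,
      ∑ k ∈ Finset.range ⌊(Nat.fib (2 * n) : ℝ) * x⌋₊,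
        w (cotPi ((k + 1 : ℕ) * goldenAlpha) / Nat.fib (2 * n)) = ∑ z ∈ B, latticeTerm w x n z := by
  classical
  -- This is the bound of `abs_unscale_le` with `c = 1 / (2 η)`, since `η q < |cot (π t)| ≤ 1 / (2
  -- |t|)` for a term with `w ≠ 0`.
  obtain ⟨N, hN⟩ := exists_nat_ge (1 + 2 * (1 / (2 * η)))
  let B : Finset (ℤ × ℤ) := Finset.Icc (-N : ℤ) N ×ˢ Finset.Icc (-N : ℤ) N
  have hB (z : ℤ × ℤ) : z ∈ B ↔ |(z.1 : ℝ)| ≤ N ∧ |(z.2 : ℝ)| ≤ N := by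
    simp only [B, Finset.mem_product, Finset.mem_Icc, abs_le]
    norm_cast
  refine ⟨B, ?_⟩
  filter_upwards [scaled_injOn (2 * N), eventually_gt_atTop 0] with n hinj hn
  have hqpos : (0 : ℝ) < Nat.fib (2 * n) := by exact_mod_cast Nat.fib_pos.2 (by omega)
  have hfloor (k : ℕ) : k + 1 ≤ ⌊(Nat.fib (2 * n) : ℝ) * x⌋₊ ↔
      ((k + 1 : ℕ) : ℝ) ≤ Nat.fib (2 * n) * x := Nat.le_floor_iff (by positivity)
  have hμ (z : ℤ × ℤ) (hz : z ∈ B) : |(z.1 : ℝ) * goldenAlpha - z.2| ≤ (2 * N : ℕ) := by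
    obtain ⟨h1, h2⟩ := (hB z).1 hz
    have := goldenAlpha_pos
    have := goldenAlpha_lt_one
    push_cast
    rw [abs_le] at h1 h2 ⊢
    constructor <;> nlinarith
  have hcast (m : ℤ) (hm : 0 < m) : (((m - 1).toNat + 1 : ℕ) : ℤ) = m := by omega
  have hcast' (m : ℤ) (hm : 0 < m) : (((m - 1).toNat + 1 : ℕ) : ℝ) = m := by
    exact_mod_cast congrArg (Int.cast : ℤ → ℝ) (hcast m hm)
  simp only [latticeTerm, ← Finset.sum_filter]
  symm
  -- The summation index `k` stands for the multiple `k + 1`, hence the shift by one.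
  refine Finset.sum_of_injOn (fun z => (scaledIndex n z - 1).toNat) ?_ ?_ ?_ ?_
  · intro z hz z' hz' he
    simp only [Finset.coe_filter, Set.mem_ofPred_eq] at hz hz'
    refine hinj z z' (hμ z hz.1) (hμ z' hz'.1) ?_
    have := hz.2.1
    have := hz'.2.1
    simp only at he
    omega
  · intro z hz
    simp only [Finset.coe_filter, Set.mem_ofPred_eq] at hz
    simp only [Finset.coe_range, Set.mem_Iio]
    rw [← Nat.succ_le_iff, Nat.succ_eq_add_one, hfloor, hcast' _ hz.2.1]
    exact hz.2.2
  · intro k hk hnot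
    by_contra hne
    rw [Finset.mem_range, ← Nat.succ_le_iff, Nat.succ_eq_add_one, hfloor] at hk
    apply hnot
    set p : ℤ := round ((k + 1 : ℕ) * goldenAlpha) with hp
    have hidx := scaledIndex_unscale n ((k + 1 : ℕ) : ℤ) p
    refine ⟨unscale n (k + 1 : ℕ) p, ?_, by simp only [hidx]; omega⟩
    simp only [Finset.coe_filter, Set.mem_ofPred_eq, hidx]
    refine ⟨?_, by omega, by exact_mod_cast hk⟩
    have hk1 : k + 1 ≤ Nat.fib (2 * n) := by
      have : ((k + 1 : ℕ) : ℝ) ≤ Nat.fib (2 * n) := hk.trans (mul_le_of_le_one_right hqpos.le hx1)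
      exact_mod_cast this
    have hlt : η < |cotPi ((k + 1 : ℕ) * goldenAlpha) / Nat.fib (2 * n)| := by
      by_contra h
      exact hne (hw _ (not_lt.1 h))
    set t := ((k + 1 : ℕ) : ℝ) * goldenAlpha - p with ht
    have ht0 : t ≠ 0 := by
      have := mul_goldenAlpha_sub_ne_zero (k := ((k + 1 : ℕ) : ℤ)) (by omega) p
      exact_mod_cast this
    have hcot := abs_cotPi_le (abs_sub_round _) ht0
    rw [← cotPi_add_int t p, ht, sub_add_cancel, ← ht] at hcot
    have htp : 0 < |t| := abs_pos.2 ht0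
    have hc : Nat.fib (2 * n) * |t| ≤ 1 / (2 * η) := by
      rw [abs_div, abs_of_pos hqpos, lt_div_iff₀ hqpos] at hlt
      have h3 := hlt.le.trans hcot
      rw [le_div_iff₀ (by positivity)] at h3 ⊢
      linarith
    obtain ⟨h1, h2⟩ := abs_unscale_le hn hk1 hc
    exact (hB _).2 ⟨h1.trans hN, h2.trans hN⟩
  · intro z hz
    rw [Finset.mem_filter] at hz
    rw [hcast' _ hz.2.1]

/-! ### Existence of the golden graph -/

theorem exists_tendsto_sum_near {η : ℝ} (hη : 0 < η) {x : ℝ} (hx0 : 0 ≤ x) (hx1 : x ≤ 1) :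
    ∃ L, Tendsto (fun n : ℕ => ∑ k ∈ Finset.range ⌊(Nat.fib (2 * n) : ℝ) * x⌋₊,
      (cotPi ((k + 1 : ℕ) * goldenAlpha) / Nat.fib (2 * n)
        - clamp η (cotPi ((k + 1 : ℕ) * goldenAlpha) / Nat.fib (2 * n)))) atTop (𝓝 L) := by
  obtain ⟨B, hB⟩ := exists_sum_eq_sum_latticeTerm (w := fun y => y - clamp η y) hη
    (fun y hy => by simp only [clamp_of_abs_le hy, sub_self]) hx0 hx1
  choose L hL using exists_tendsto_latticeTerm (w := fun y => y - clamp η y)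
    (continuous_id.sub (continuous_clamp η)) x
  exact ⟨_, (tendsto_finsetSum B fun z _ => hL z).congr' (hB.mono fun n hn => hn.symm)⟩

theorem exists_tendsto_sum_cotPi {x : ℝ} (hx0 : 0 ≤ x) (hx1 : x ≤ 1) :
    ∃ L, Tendsto (fun n : ℕ => (∑ k ∈ Finset.range ⌊(Nat.fib (2 * n) : ℝ) * x⌋₊,
      cotPi ((k + 1 : ℕ) * goldenAlpha)) / Nat.fib (2 * n)) atTop (𝓝 L) := by
  obtain ⟨C, hC, hbound⟩ := exists_abs_sum_clamp_le
  refine cauchySeq_tendsto_of_complete (Metric.cauchySeq_iff'.2 fun ε hε => ?_)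
  -- The limit `L` of the excess depends on `η`, so it is not the limit sought; it only serves as a
  -- common centre for the Cauchy estimate.
  obtain ⟨η, hη, hηε⟩ : ∃ η : ℝ, 0 < η ∧ C * √η = ε / 4 := by
    refine ⟨(ε / 4 / C) ^ 2, by positivity, ?_⟩
    rw [Real.sqrt_sq (by positivity)]
    field_simp
  obtain ⟨L, hL⟩ := exists_tendsto_sum_near hη hx0 hx1
  have hclose : ∀ᶠ n : ℕ in atTop, |(∑ k ∈ Finset.range ⌊(Nat.fib (2 * n) : ℝ) * x⌋₊,
      cotPi ((k + 1 : ℕ) * goldenAlpha)) / Nat.fib (2 * n) - L| < ε / 2 := by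
    filter_upwards [Metric.tendsto_nhds.1 hL (ε / 4) (by positivity), eventually_gt_atTop 0]
      with n hn hn0
    have hqpos : (0 : ℝ) < Nat.fib (2 * n) := by exact_mod_cast Nat.fib_pos.2 (by omega)
    have hm : ⌊(Nat.fib (2 * n) : ℝ) * x⌋₊ ≤ Nat.fib (2 * n) :=
      Nat.floor_le_of_le (mul_le_of_le_one_right hqpos.le hx1)
    have hb := hbound (2 * n) (by omega) η hη.le _ hm
    simp only [clamp_mul hqpos] at hb
    rw [← Finset.sum_mul, abs_mul, abs_of_pos hqpos, mul_le_mul_iff_left₀ hqpos, hηε] at hb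
    rw [Real.dist_eq, Finset.sum_sub_distrib, ← Finset.sum_div] at hn
    rw [abs_le] at hb
    rw [abs_lt] at hn ⊢
    constructor <;> linarith
  obtain ⟨n₀, hn₀⟩ := eventually_atTop.1 hclose
  refine ⟨n₀, fun n hn => ?_⟩
  have h1 := abs_lt.1 (hn₀ n hn)
  have h2 := abs_lt.1 (hn₀ n₀ le_rfl)
  rw [Real.dist_eq, abs_lt]
  constructor <;> linarith

/-! ### Equidistribution of the golden rotation -/

theorem tendsto_average_fourier (j : ℤ) :
    Tendsto (fun m : ℕ => (∑ k ∈ Finset.range m,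
        fourier j ((((k + 1 : ℕ) : ℝ) * goldenAlpha : ℝ) : UnitAddCircle)) / (m : ℂ)) atTop
      (𝓝 (∫ t in (0 : ℝ)..1, fourier j (t : UnitAddCircle))) := by
  rcases eq_or_ne j 0 with rfl | hj
  · simp only [fourier_zero, Finset.sum_const, Finset.card_range, nsmul_eq_mul, mul_one,
      intervalIntegral.integral_const, sub_zero, one_smul]
    refine tendsto_const_nhds.congr' ?_
    filter_upwards [eventually_gt_atTop 0] with m hm
    rw [div_self (by exact_mod_cast hm.ne')]
  · have hc : (2 * Real.pi * Complex.I * j : ℂ) ≠ 0 := by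
      simp [Real.pi_ne_zero, hj]
    have hint : ∫ t in (0 : ℝ)..1, (fourier j (t : UnitAddCircle) : ℂ) = 0 := by
      simp only [fourier_coe_apply, Complex.ofReal_one, div_one]
      rw [integral_exp_mul_complex hc]
      have : (2 * Real.pi * Complex.I * j : ℂ) = j * (2 * Real.pi * Complex.I) := by ring
      simp [this, Complex.exp_int_mul_two_pi_mul_I]
    rw [hint]
    set z : ℂ := Complex.exp (2 * Real.pi * Complex.I * j * goldenAlpha) with hz
    have hz1 : z ≠ 1 := by
      intro h
      rw [hz, Complex.exp_eq_one_iff] at h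
      obtain ⟨p, hp⟩ := h
      have h2 : (2 * Real.pi * Complex.I : ℂ) ≠ 0 := by simp [Real.pi_ne_zero]
      have h3 : (j : ℂ) * goldenAlpha = p := by
        apply mul_left_cancel₀ h2
        linear_combination hp
      have h4 : (j : ℝ) * goldenAlpha = p := by exact_mod_cast h3
      exact mul_goldenAlpha_sub_ne_zero hj p (sub_eq_zero.2 h4)
    have hnorm : ‖z‖ = 1 := by
      have : (2 * Real.pi * Complex.I * j * goldenAlpha : ℂ)
          = ((2 * Real.pi * j * goldenAlpha : ℝ) : ℂ) * Complex.I := by push_cast; ring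
      rw [hz, this, Complex.norm_exp_ofReal_mul_I]
    have hterm (k : ℕ) :
        fourier j ((((k + 1 : ℕ) : ℝ) * goldenAlpha : ℝ) : UnitAddCircle) = z * z ^ k := by
      rw [fourier_coe_apply, ← pow_succ', hz, ← Complex.exp_nat_mul]
      congr 1
      push_cast
      ring
    simp only [hterm, ← Finset.mul_sum, geom_sum_eq hz1]
    rw [tendsto_zero_iff_norm_tendsto_zero]
    refine squeeze_zero (fun m => norm_nonneg _) (fun m => ?_)
      (tendsto_const_div_atTop_nhds_zero_nat (2 / ‖z - 1‖))
    rw [norm_div, norm_mul, hnorm, one_mul, norm_div, Complex.norm_natCast]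
    gcongr
    refine (norm_sub_le _ _).trans ?_
    rw [norm_pow, hnorm, one_pow, norm_one]
    norm_num

/-- Weyl's criterion: the geometric sums settle the characters, and trigonometric polynomials are
uniformly dense. -/
theorem tendsto_average_complex (f : C(UnitAddCircle, ℂ)) :
    Tendsto (fun m : ℕ => (∑ k ∈ Finset.range m,
        f ((((k + 1 : ℕ) : ℝ) * goldenAlpha : ℝ) : UnitAddCircle)) / (m : ℂ)) atTop
      (𝓝 (∫ t in (0 : ℝ)..1, f (t : UnitAddCircle))) := by
  have hcont (g : C(UnitAddCircle, ℂ)) : Continuous fun t : ℝ => g (t : UnitAddCircle) :=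
    g.continuous.comp (AddCircle.continuous_mk' 1)
  have hspan (P : C(UnitAddCircle, ℂ))
      (hP : P ∈ Submodule.span ℂ (Set.range (@fourier (1 : ℝ)))) :
      Tendsto (fun m : ℕ => (∑ k ∈ Finset.range m,
          P ((((k + 1 : ℕ) : ℝ) * goldenAlpha : ℝ) : UnitAddCircle)) / (m : ℂ)) atTop
        (𝓝 (∫ t in (0 : ℝ)..1, P (t : UnitAddCircle))) := by
    induction hP using Submodule.span_induction with
    | mem P hP =>
      obtain ⟨j, rfl⟩ := hP
      exact tendsto_average_fourier j
    | zero => simp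
    | add P R _ _ hP hR =>
      simp only [ContinuousMap.add_apply, Finset.sum_add_distrib, add_div]
      rw [intervalIntegral.integral_add ((hcont P).intervalIntegrable _ _)
        ((hcont R).intervalIntegrable _ _)]
      exact hP.add hR
    | smul a P _ hP =>
      simp only [ContinuousMap.smul_apply, smul_eq_mul, ← Finset.mul_sum, mul_div_assoc,
        intervalIntegral.integral_const_mul]
      exact hP.const_mul a
  rw [Metric.tendsto_nhds]
  intro ε hε
  have hmem : f ∈ closure (Submodule.span ℂ (Set.range (@fourier (1 : ℝ))) : Set _) := by
    rw [← Submodule.topologicalClosure_coe, span_fourier_closure_eq_top]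
    trivial
  obtain ⟨P, hP, hfP⟩ := Metric.mem_closure_iff.1 hmem (ε / 3) (by positivity)
  have hpt (y : UnitAddCircle) : ‖f y - P y‖ ≤ ε / 3 := by
    rw [← dist_eq_norm]
    exact (ContinuousMap.dist_apply_le_dist y).trans hfP.le
  filter_upwards [Metric.tendsto_nhds.1 (hspan P hP) (ε / 3) (by positivity),
    eventually_gt_atTop 0] with m hm hm0
  have hm0' : (0 : ℝ) < m := by exact_mod_cast hm0
  have h1 : ‖(∑ k ∈ Finset.range m, f ((((k + 1 : ℕ) : ℝ) * goldenAlpha : ℝ) : UnitAddCircle))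
      / (m : ℂ) - (∑ k ∈ Finset.range m,
        P ((((k + 1 : ℕ) : ℝ) * goldenAlpha : ℝ) : UnitAddCircle)) / (m : ℂ)‖ ≤ ε / 3 := by
    rw [← sub_div, ← Finset.sum_sub_distrib, norm_div, Complex.norm_natCast, div_le_iff₀ hm0']
    refine (norm_sum_le_of_le _ fun k _ => hpt _).trans ?_
    simp [mul_comm]
  have h2 : ‖(∫ t in (0 : ℝ)..1, P (t : UnitAddCircle)) - ∫ t in (0 : ℝ)..1, f (t : UnitAddCircle)‖
      ≤ ε / 3 := by
    rw [← intervalIntegral.integral_sub ((hcont P).intervalIntegrable _ _)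
        ((hcont f).intervalIntegrable _ _)]
    refine (intervalIntegral.norm_integral_le_of_norm_le_const (C := ε / 3) fun t _ => ?_).trans ?_
    · rw [norm_sub_rev]
      exact hpt _
    · simp
  rw [dist_eq_norm] at hm ⊢
  calc _ ≤ _ := norm_sub_le_norm_sub_add_norm_sub _ _ _
    _ ≤ _ := add_le_add_right (norm_sub_le_norm_sub_add_norm_sub _ _ _) _
    _ < ε := by linarith

theorem tendsto_average (F : C(UnitAddCircle, ℝ)) :
    Tendsto (fun m : ℕ => (∑ k ∈ Finset.range m,
        F ((((k + 1 : ℕ) : ℝ) * goldenAlpha : ℝ) : UnitAddCircle)) / (m : ℝ)) atTop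
      (𝓝 (∫ t in (0 : ℝ)..1, F (t : UnitAddCircle))) := by
  have h := tendsto_average_complex
    ⟨fun y => (F y : ℂ), Complex.continuous_ofReal.comp F.continuous⟩
  simp only [ContinuousMap.coe_mk, intervalIntegral.integral_ofReal] at h
  refine ((Complex.continuous_re.tendsto _).comp h).congr fun m => ?_
  rw [Function.comp_apply, ← Complex.ofReal_sum, ← Complex.ofReal_natCast, ← Complex.ofReal_div,
    Complex.ofReal_re]

/-! ### Birkhoff limiting functions -/

theorem birkhoffFunction_eq (g : UnitAddCircle → ℝ) (m : ℕ) (x : ℝ) :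
    birkhoffFunction g m x = (∑ k ∈ Finset.range ⌊(m : ℝ) * x⌋₊,
      g ((((k + 1 : ℕ) : ℝ) * goldenAlpha : ℝ) : UnitAddCircle)) / m := by
  rw [birkhoffFunction, goldenBirkhoffSum, Finset.range_eq_Ico,
    Finset.sum_Ico_add' (fun k : ℕ => g (((k : ℝ) * goldenAlpha : ℝ) : UnitAddCircle)) 0 _ 1]
  simp only [zero_add]
  rfl

theorem circleCot_coe (t : ℝ) : circleCot (t : UnitAddCircle) = cotPi t := rfl

theorem tendsto_birkhoffFunction_circleCot {x : ℝ} (hx : x ∈ Set.Icc (0 : ℝ) 1) :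
    Tendsto (fun n : ℕ => birkhoffFunction circleCot (goldenDenom (2 * n)) x) atTop
      (𝓝 (goldenGraph x)) := by
  refine tendsto_nhds_limUnder ?_
  obtain ⟨L, hL⟩ := exists_tendsto_sum_cotPi hx.1 hx.2
  refine ⟨L, hL.congr fun n => ?_⟩
  rw [birkhoffFunction_eq]
  rfl

theorem tendsto_birkhoffFunction_continuousMap (F : C(UnitAddCircle, ℝ)) {x : ℝ} (hx : 0 ≤ x) :
    Tendsto (fun n : ℕ => birkhoffFunction F (goldenDenom (2 * n)) x) atTop
      (𝓝 ((∫ t in (0 : ℝ)..1, F (t : UnitAddCircle)) * x)) := by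
  simp only [birkhoffFunction_eq, goldenDenom]
  rcases hx.eq_or_lt with rfl | hx
  -- At `x = 0` the number of summands does not tend to infinity, so equidistribution is not
  -- available, but the sums are empty.
  · simp
  have hq := tendsto_fib_two_mul
  have hm := tendsto_nat_floor_atTop.comp (hq.atTop_mul_const hx)
  have h1 := (tendsto_average F).comp hm
  have h2 := (tendsto_nat_floor_mul_div_atTop hx.le).comp hq
  refine (h1.mul h2).congr' ?_
  filter_upwards [hm.eventually_gt_atTop 0] with n hn
  simp only [Function.comp_apply] at hn ⊢
  have hn' : ((⌊(Nat.fib (2 * n) : ℝ) * x⌋₊ : ℕ) : ℝ) ≠ 0 := by exact_mod_cast hn.ne'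
  rw [mul_comm x, div_mul_div_cancel₀ hn']

/-! ### Functions with a single simple pole -/

/-- With `s = π t` the difference is `(s cos s - sin s) / (t sin s)`: a numerator of third order
over a denominator of second order. -/
theorem tendsto_cotPi_sub :
    Tendsto (fun t : ℝ => Real.pi * cotPi t - 1 / t) (𝓝[≠] 0) (𝓝 0) := by
  have hpi := Real.pi_pos
  have hlim : Tendsto (fun t : ℝ => Real.pi ^ 3 / 2 * |t|) (𝓝[≠] 0) (𝓝 0) := by
    have : Continuous fun t : ℝ => Real.pi ^ 3 / 2 * |t| := by fun_prop
    simpa using (this.tendsto 0).mono_left nhdsWithin_le_nhds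
  refine squeeze_zero_norm' ?_ hlim
  have hev : ∀ᶠ t : ℝ in 𝓝[≠] 0, |t| < 1 / Real.pi ∧ |t| < 1 / 2 := by
    have h : Tendsto (fun t : ℝ => |t|) (𝓝[≠] 0) (𝓝 0) := by
      simpa using (continuous_abs.tendsto (0 : ℝ)).mono_left nhdsWithin_le_nhds
    exact (h.eventually_lt_const (by positivity)).and (h.eventually_lt_const (by norm_num))
  filter_upwards [hev, self_mem_nhdsWithin] with t ht ht0
  have ht0' : 0 < |t| := abs_pos.2 ht0
  set s := Real.pi * t with hs
  have habs : |s| = Real.pi * |t| := by rw [hs, abs_mul, abs_of_pos hpi]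
  have hs1 : |s| ≤ 1 := by
    have := ht.1.le
    rw [le_div_iff₀ hpi] at this
    rw [habs]
    linarith
  have hsin : 2 * |t| ≤ |Real.sin s| := by
    have h1 := Real.mul_abs_le_abs_sin (x := s) (by rw [habs]; nlinarith [ht.2])
    rw [habs, ← mul_assoc, div_mul_cancel₀ _ hpi.ne'] at h1
    exact h1
  have hsin0 : Real.sin s ≠ 0 := abs_pos.1 (by linarith)
  have hnum : |s * Real.cos s - Real.sin s| ≤ |s| ^ 3 := by
    have h1 := Real.sin_bound hs1
    have h2 := Real.cos_bound hs1
    have e : s * Real.cos s - Real.sin s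
        = s * (Real.cos s - (1 - s ^ 2 / 2)) - (Real.sin s - (s - s ^ 3 / 6)) - s ^ 3 / 3 := by
      ring
    have h3 : |s * (Real.cos s - (1 - s ^ 2 / 2))| ≤ |s| ^ 3 * (5 / 96) := by
      rw [abs_mul]
      calc |s| * |Real.cos s - (1 - s ^ 2 / 2)| ≤ 1 * (|s| ^ 4 * (5 / 96)) := by gcongr
        _ ≤ |s| ^ 3 * (5 / 96) := by
          rw [one_mul]
          gcongr ?_ * _
          exact pow_le_pow_of_le_one (abs_nonneg s) hs1 (by norm_num)
    have h4 : |Real.sin s - (s - s ^ 3 / 6)| ≤ |s| ^ 3 / 100 := by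
      refine h1.trans ?_
      gcongr ?_ / _
      exact pow_le_pow_of_le_one (abs_nonneg s) hs1 (by norm_num)
    have h5 : |s ^ 3 / 3| = |s| ^ 3 / 3 := by
      rw [abs_div, abs_pow]
      norm_num
    rw [e]
    have h6 := abs_sub (s * (Real.cos s - (1 - s ^ 2 / 2)) - (Real.sin s - (s - s ^ 3 / 6)))
      (s ^ 3 / 3)
    have h7 := abs_sub (s * (Real.cos s - (1 - s ^ 2 / 2))) (Real.sin s - (s - s ^ 3 / 6))
    have h8 : 0 ≤ |s| ^ 3 := by positivity
    linarith
  have e : Real.pi * cotPi t - 1 / t = (s * Real.cos s - Real.sin s) / (t * Real.sin s) := by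
    have ht0'' : t ≠ 0 := ht0
    rw [cotPi, Real.cot_eq_cos_div_sin, ← hs]
    field_simp
    rw [hs]
    ring
  rw [Real.norm_eq_abs, e, abs_div, abs_mul, div_le_iff₀ (by positivity)]
  calc |s * Real.cos s - Real.sin s| ≤ |s| ^ 3 := hnum
    _ = Real.pi ^ 3 / 2 * |t| * (|t| * (2 * |t|)) := by rw [habs]; ring
    _ ≤ _ := by gcongr

/-- The quotient map is open, so a limit in the coordinate `t` transfers to the circle. -/
theorem nhdsNE_zero_unitAddCircle_le :
    𝓝[≠] (0 : UnitAddCircle) ≤ map (fun t : ℝ => (t : UnitAddCircle)) (𝓝[≠] 0) := by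
  intro U hU
  rw [mem_map, mem_nhdsWithin_iff_exists_mem_nhds_inter] at hU
  obtain ⟨V, hV, hVU⟩ := hU
  rw [mem_nhdsWithin_iff_exists_mem_nhds_inter]
  refine ⟨_, QuotientAddGroup.isOpenMap_coe.image_mem_nhds hV, ?_⟩
  rintro _ ⟨⟨t, ht, rfl⟩, h0⟩
  refine hVU ⟨ht, fun h => h0 ?_⟩
  rw [Set.mem_singleton_iff] at h ⊢
  rw [h]
  rfl

theorem continuousAt_circleCot {θ : UnitAddCircle} (hθ : θ ≠ 0) : ContinuousAt circleCot θ := by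
  induction θ using QuotientAddGroup.induction_on with
  | H t =>
    refine QuotientAddGroup.isOpenQuotientMap_mk.continuousAt_comp_iff.1 ?_
    have hsin : Real.sin (Real.pi * t) ≠ 0 := by
      intro h
      obtain ⟨n, hn⟩ := Real.sin_eq_zero_iff.1 h
      rw [mul_comm, mul_right_inj' Real.pi_ne_zero] at hn
      exact hθ ((AddCircle.coe_eq_zero_iff (1 : ℝ)).2 ⟨n, by rw [zsmul_one, hn]⟩)
    have h : ContinuousAt (fun t : ℝ => Real.cos (Real.pi * t) / Real.sin (Real.pi * t)) t :=
      ContinuousAt.div (by fun_prop) (by fun_prop) hsin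
    simp only [← Real.cot_eq_cos_div_sin] at h
    exact h

theorem exists_continuousMap_eq {g : UnitAddCircle → ℝ} {r : ℝ} (hg : HasSinglePole g r) :
    ∃ F : C(UnitAddCircle, ℝ),
      ∀ θ : UnitAddCircle, θ ≠ 0 → g θ = (Real.pi * r) * circleCot θ + F θ := by
  obtain ⟨L, hL⟩ := hg.pole
  let G : UnitAddCircle → ℝ := fun θ => g θ - (Real.pi * r) * circleCot θ
  have hG : Continuous (Function.update G 0 L) := by
    rw [continuous_iff_continuousAt]
    intro θ
    rcases eq_or_ne θ 0 with rfl | hθ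
    · rw [continuousAt_update_same]
      refine Tendsto.mono_left (tendsto_map'_iff.2 ?_) nhdsNE_zero_unitAddCircle_le
      have h := hL.sub (tendsto_cotPi_sub.const_mul r)
      rw [mul_zero, sub_zero] at h
      refine h.congr fun t => ?_
      simp only [Function.comp_apply, G, circleCot_coe]
      ring
    · rw [continuousAt_update_of_ne hθ]
      exact (hg.continuousOn.continuousAt (isOpen_compl_singleton.mem_nhds hθ)).sub
        ((continuousAt_circleCot hθ).const_mul _)
  refine ⟨⟨_, hG⟩, fun θ hθ => ?_⟩
  simp [Function.update_of_ne hθ, G]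

theorem mainTheorem4 :
    (∀ x ∈ Set.Icc (0 : ℝ) 1,
      Tendsto (fun n : ℕ => birkhoffFunction circleCot (goldenDenom (2 * n)) x) atTop
        (𝓝 (goldenGraph x))) ∧
    ∀ (g : UnitAddCircle → ℝ) (r : ℝ), HasSinglePole g r →
      ∃ F : C(UnitAddCircle, ℝ),
        (∀ θ : UnitAddCircle, θ ≠ 0 → g θ = (Real.pi * r) * circleCot θ + F θ) ∧
        ∀ x ∈ Set.Icc (0 : ℝ) 1,
          Tendsto (fun n : ℕ => birkhoffFunction g (goldenDenom (2 * n)) x) atTop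
            (𝓝 ((Real.pi * r) * goldenGraph x
              + (∫ t in (0 : ℝ)..1, F (t : UnitAddCircle)) * x)) := by
  refine ⟨fun x hx => tendsto_birkhoffFunction_circleCot hx, fun g r hg => ?_⟩
  obtain ⟨F, hF⟩ := exists_continuousMap_eq hg
  refine ⟨F, hF, fun x hx => ?_⟩
  refine (((tendsto_birkhoffFunction_circleCot hx).const_mul (Real.pi * r)).add
    (tendsto_birkhoffFunction_continuousMap F hx.1)).congr fun n => ?_
  simp only [birkhoffFunction_eq]
  rw [← mul_div_assoc, ← add_div, Finset.mul_sum, ← Finset.sum_add_distrib]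
  congr 1
  -- The orbit starts at `α`, and by irrationality it never meets `0`, so the values of `g` and
  -- `circleCot` there play no role.
  refine Finset.sum_congr rfl fun k _ => (hF _ fun h => ?_).symm
  rw [AddCircle.coe_eq_zero_iff] at h
  obtain ⟨p, hp⟩ := h
  rw [zsmul_one] at hp
  have := mul_goldenAlpha_sub_ne_zero (k := ((k + 1 : ℕ) : ℤ)) (by omega) p
  rw [Int.cast_natCast] at this
  exact this (by linarith)
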